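/- Let $V=(V,\bigvee,\otimes,k)$ be a commutative quantale whose underlying lattice is completely distributive, with $k=\top$. Write $U$ for the ultrafilter monad on sets, put $\xi:UV\to V$, $\xi(\mathfrak x)=\bigwedge_{A\in\mathfrak x}\bigvee A$, and suppose that $\otimes$ is continuous for the compact Hausdorff topology $\xi$, i.e. $\xi(U(\otimes)(\mathfrak w))=\xi(U\pi_1\mathfrak w)\otimes\xi(U\pi_2\mathfrak w)$ for all $\mathfrak w\in U(V\times V)$ (so $(U,V,\xi)$ is an ultrafilter theory). Let $\hom(y,-)$ be right adjoint to $-\otimes y$, and $u\ll v$ the totally below relation: whenever $v\le\bigvee S$, some $s\in S$ has $u\le s$. A $U$-graph is a set $X$ with $a:UX\times X\to V$ such that $k\le a(\dot x,x)$ for all $x$, where $\dot x$ is the principal ultrafilter. It is a $U$-category if moreover $U_\xi a(\mathfrak X,\mathfrak y)\otimes a(\mathfrak y,x)\le a(m\mathfrak X,x)$ for $\mathfrak X\in UUX$, $\mathfrak y\in UX$, $x\in X$, where $m$ is the multiplication of $U$ and $U_\xi a(\mathfrak X,\mathfrak y)=\bigvee\{\xi(Ua(\mathfrak w)) : \mathfrak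 w\in U(UX\times X),\ U\pi_1\mathfrak w=\mathfrak X,\ U\pi_2\mathfrak w=\mathfrak y\}$. A map $f:(X,a)\to(Y,b)$ is a $U$-graph morphism ($U$-functor, between $U$-categories) if $a(\mathfrak x,x)\le b(Uf(\mathfrak x),f(x))$. $V$ is a $U$-category via $(\mathfrak v,v)\mapsto\hom(\xi(\mathfrak v),v)$; a $U$-algebra $(I,\alpha)$ is one with value $k$ at $(\mathfrak i,i)$ if $\alpha(\mathfrak i)=i$ and $\bot$ otherwise. For a $U$-category $X=(X,a)$, let $\Omega(X)$ be the set of $U$-functors $X\to V$, with the $V$-category structure $[\varphi,\varphi']=\bigwedge_x\hom(\varphi(x),\varphi'(x))$ and the $U$-graph structure $$\langle\mathfrak p,\varphi\rangle=\bigwedge_{\mathfrak q\in U(X\times\Omega(X)),\ U\pi_2\mathfrak q=\mathfrak p,\ x\in X}\hom\bigl(a(U\pi_1\mathfrak q,x),\hom(\xi\cdot U\mathrm{ev}(\mathfrak q),\varphi(x))\bigr).$$ A map $\Phi:\Omega(X)\to V$ is $U$-compatible if $\Phi\cdot h$ is a $U$-graph morphism for every $U$-algebra $I$ and every $U$-graph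 morphism $h:I\to\Omega(X)$; it preserves $U$-suprema if it preserves the suprema of all $U$-diagrams, i.e. $U$-graph morphisms $D:I\to\Omega(X)$ with $I$ a $U$-algebra. Suprema, infima, tensors and cotensors are meant in the $V$-enriched sense. A $U$-frame homomorphism $\Omega(X)\to V$ is a $U$-compatible $V$-functor that preserves infima, tensors, cotensors and $U$-suprema. **Proposition.** Assume that $\top=k$, that $\{u\in V\mid u\ll k\}$ is directed, and that $k\le u\vee v$ implies $k\le u$ or $k\le v$ for all $u,v\in V$. Let $X$ be a $U$-category and $\Phi:\Omega(X)\to V$ a $V$-functor that preserves infima, tensors and cotensors. Then $\Phi$ is $U$-compatible, and $\Phi$ preserves $U$-suprema if and only if $\Phi$ preserves finite suprema (including the empty one). In particular: 1. (Topological case.) The two-element chain $2$ with $\otimes=\wedge$ gives an ultrafilter theory. For a topological space $X$, regarded as a $U$-category with $a(\mathfrak x,x)$ the truth value of $\mathfrak x\to x$, taking characteristic functions is an isomorphism of ordered sets from the co-frame of closed subsets of $X$ onto $\Omega(X)$, and under it the $U$-frame homomorphisms $\Omega(X)\to2$ are exactly the co-frame homomorphisms, i.e. the maps that preserve arbitrary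 infima and finite suprema. 2. (Approach case.) $([0,\infty],\ge,+,0)$ gives an ultrafilter theory. For every $U$-category $X$ (approach space), a map $\Phi:\Omega(X)\to[0,\infty]$ is a $U$-frame homomorphism if and only if it is a $V$-functor (non-expansive map) that preserves infima, tensors, cotensors and finite suprema. -/

import Mathlib

open Filter Topology TopologicalSpace

universe u v w

namespace UTheory

section Quantale

/-- The internal hom of a commutative quantale: `x * y ≤ z ↔ x ≤ qhom y z`. -/
def qhom {V : Type v} [CommMonoid V] [CompleteLattice V] [IsQuantale V] (y z : V) : V :=
  Quantale.leftMulResiduation y z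

theorem le_qhom {V : Type v} [CommMonoid V] [CompleteLattice V] [IsQuantale V] {x y z : V} :
    x ≤ qhom y z ↔ x * y ≤ z :=
  Quantale.leftMulResiduation_le_iff_mul_le

/-- The totally below relation `u ≪ v` of a complete lattice. -/
def TotallyBelow {V : Type v} [CompleteLattice V] (u v : V) : Prop :=
  ∀ S : Set V, v ≤ sSup S → ∃ s ∈ S, u ≤ s

/-- The structure map `ξ : U V → V`, `ξ 𝔵 = ⋀_{A ∈ 𝔵} ⋁ A`. -/
def xi {V : Type v} [CompleteLattice V] (𝔵 : Ultrafilter V) : V :=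
  ⨅ A ∈ 𝔵, sSup A

theorem xi_le {V : Type v} [CompleteLattice V] {𝔵 : Ultrafilter V} {A : Set V} (hA : A ∈ 𝔵) :
    xi 𝔵 ≤ sSup A :=
  iInf₂_le A hA

theorem xi_pure_le {V : Type v} [CompleteLattice V] (x : V) : xi (pure x : Ultrafilter V) ≤ x := by
  have h : ({x} : Set V) ∈ (pure x : Ultrafilter V) := Ultrafilter.mem_pure.2 rfl
  simpa using xi_le h

/-- The ultrafilter theory over the completely distributive commutative quantale `V`
(with structure map `xi`): `V` is integral, and the tensor `V × V → V` is continuous for the compact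
Hausdorff topology on `V` whose ultrafilter convergence is `xi`, i.e. it is a homomorphism of
algebras of the ultrafilter monad `(V, ξ) × (V, ξ) → (V, ξ)`. -/
structure IsUltrafilterTheory (V : Type v) [CommMonoid V] [CompletelyDistribLattice V]
    [IsQuantale V] : Prop where
  one_eq_top : (1 : V) = ⊤
  xi_map_mul : ∀ 𝔴 : Ultrafilter (V × V),
    xi (𝔴.map fun p => p.1 * p.2) = xi (𝔴.map Prod.fst) * xi (𝔴.map Prod.snd)

end Quantale

section Monad

/-- The multiplication of the ultrafilter monad: `A ∈ mu 𝔛 ↔ {𝔵 | A ∈ 𝔵} ∈ 𝔛`. -/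
def mu {X : Type u} (𝔛 : Ultrafilter (Ultrafilter X)) : Ultrafilter X :=
  𝔛.bind id

theorem mem_mu {X : Type u} {𝔛 : Ultrafilter (Ultrafilter X)} {A : Set X} :
    A ∈ mu 𝔛 ↔ {𝔵 : Ultrafilter X | A ∈ 𝔵} ∈ 𝔛 :=
  Iff.rfl

/-- Eilenberg-Moore algebras of the ultrafilter monad. -/
structure UAlgebra (I : Type w) where
  str : Ultrafilter I → I
  str_pure : ∀ i, str (pure i) = i
  str_map_str : ∀ 𝔍 : Ultrafilter (Ultrafilter I), str (𝔍.map str) = str (mu 𝔍)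

end Monad

section Graphs

variable {V : Type v} [CommMonoid V] [CompleteLattice V] [IsQuantale V]

/-- The lax extension of the ultrafilter functor to `V`-matrices; a matrix `r : X ⇸ Y` is
written as a function `Y → X → V`. -/
def laxExt {X : Type u} {Y : Type w} (r : Y → X → V) (𝔶 : Ultrafilter Y) (𝔵 : Ultrafilter X) : V :=
  ⨆ (𝔴 : Ultrafilter (Y × X)) (_ : 𝔴.map Prod.fst = 𝔶) (_ : 𝔴.map Prod.snd = 𝔵),
    xi (𝔴.map fun p => r p.1 p.2)

/-- The Kleisli composition `b ∘ a = m · U_ξ b · a` of `U`-matrices `a, b : X ⇸ U X`. -/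
def kleisli {X : Type u} (b a : Ultrafilter X → X → V) (𝔵 : Ultrafilter X) (x : X) : V :=
  ⨆ (𝔛 : Ultrafilter (Ultrafilter X)) (_ : mu 𝔛 = 𝔵) (𝔶 : Ultrafilter X),
    laxExt b 𝔛 𝔶 * a 𝔶 x

variable (V) in
/-- `U`-graphs with underlying set `X`. -/
structure UGraph (X : Type u) where
  str : Ultrafilter X → X → V
  refl : ∀ x, 1 ≤ str (pure x) x

variable (V) in
/-- `U`-categories with underlying set `X`. -/
structure UCat (X : Type u) extends UGraph V X where
  trans : ∀ 𝔵 x, kleisli str str 𝔵 x ≤ str 𝔵 x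

/-- `U`-graph morphisms; between `U`-categories these are the `U`-functors. -/
def IsMorphism {X : Type u} {Y : Type w} (a : UGraph V X) (b : UGraph V Y) (f : X → Y) : Prop :=
  ∀ 𝔵 x, a.str 𝔵 x ≤ b.str (𝔵.map f) (f x)

variable (V) in
/-- `V` itself as a `U`-graph (indeed a `U`-category), with structure `hom_ξ`. -/
def homXi : UGraph V V where
  str 𝔳 x := qhom (xi 𝔳) x
  refl x := by
    rw [le_qhom, one_mul]
    exact xi_pure_le x

variable (V) in
/-- An algebra of the ultrafilter monad, regarded as a `U`-graph (indeed a `U`-category):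
the structure matrix has entry `k` where `α 𝔦 = i` and `⊥` elsewhere. -/
def UAlgebra.toUGraph {I : Type w} (α : UAlgebra I) : UGraph V I where
  str 𝔦 i := ⨆ (_ : α.str 𝔦 = i), 1
  refl i := le_iSup_of_le (α.str_pure i) le_rfl

end Graphs

section VCategories

variable {V : Type v} [CommMonoid V] [CompleteLattice V] [IsQuantale V]

variable (V) in
/-- `V`-categories with set of objects `A`. -/
structure VCat (A : Type u) where
  hom : A → A → V
  refl : ∀ x, 1 ≤ hom x x
  trans : ∀ x y z, hom x y * hom y z ≤ hom x z

variable (V) in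
/-- The `V`-category `V`. -/
def homV : VCat V V where
  hom := qhom
  refl x := by rw [le_qhom, one_mul]
  trans x y z := by
    rw [le_qhom, mul_right_comm]
    calc qhom x y * x * qhom y z ≤ y * qhom y z := mul_le_mul_left (le_qhom.1 le_rfl) _
      _ = qhom y z * y := mul_comm _ _
      _ ≤ z := le_qhom.1 le_rfl

variable {A : Type u} {B : Type w}

/-- `V`-functors. -/
def IsVFunctor (𝒜 : VCat V A) (ℬ : VCat V B) (Φ : A → B) : Prop :=
  ∀ x y, 𝒜.hom x y ≤ ℬ.hom (Φ x) (Φ y)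

/-- `m` is an infimum (conical limit) of the family `S` of objects. -/
def IsInfimum (𝒜 : VCat V A) (S : Set A) (m : A) : Prop :=
  ∀ y, 𝒜.hom y m = ⨅ s ∈ S, 𝒜.hom y s

/-- `m` is a supremum (conical colimit) of the family `S` of objects. -/
def IsSupremum (𝒜 : VCat V A) (S : Set A) (m : A) : Prop :=
  ∀ y, 𝒜.hom m y = ⨅ s ∈ S, 𝒜.hom s y

/-- `t` is the tensor of `x` with `r`. -/
def IsTensor (𝒜 : VCat V A) (r : V) (x t : A) : Prop :=
  ∀ y, 𝒜.hom t y = qhom r (𝒜.hom x y)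

/-- `c` is the cotensor of `x` with `r`. -/
def IsCotensor (𝒜 : VCat V A) (r : V) (x c : A) : Prop :=
  ∀ y, 𝒜.hom y c = qhom r (𝒜.hom y x)

def PreservesInfima (𝒜 : VCat V A) (ℬ : VCat V B) (Φ : A → B) : Prop :=
  ∀ S m, IsInfimum 𝒜 S m → IsInfimum ℬ (Φ '' S) (Φ m)

def PreservesTensors (𝒜 : VCat V A) (ℬ : VCat V B) (Φ : A → B) : Prop :=
  ∀ r x t, IsTensor 𝒜 r x t → IsTensor ℬ r (Φ x) (Φ t)

def PreservesCotensors (𝒜 : VCat V A) (ℬ : VCat V B) (Φ : A → B) : Prop :=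
  ∀ r x c, IsCotensor 𝒜 r x c → IsCotensor ℬ r (Φ x) (Φ c)

def PreservesFiniteSuprema (𝒜 : VCat V A) (ℬ : VCat V B) (Φ : A → B) : Prop :=
  ∀ S : Set A, S.Finite → ∀ m, IsSupremum 𝒜 S m → IsSupremum ℬ (Φ '' S) (Φ m)

end VCategories

section Omega

variable {V : Type v} [CommMonoid V] [CompleteLattice V] [IsQuantale V] {X : Type u}

/-- The set of `U`-functors from the `U`-category `(X, a)` to `V`. -/
def Omega (a : UCat V X) : Type (max u v) :=
  {φ : X → V // IsMorphism a.toUGraph (homXi V) φ}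

/-- `Ω(X)` as a `V`-category: `[φ, φ'] = ⋀ₓ hom (φ x) (φ' x)`. -/
def Omega.vcat (a : UCat V X) : VCat V (Omega a) where
  hom φ φ' := ⨅ x, qhom (φ.1 x) (φ'.1 x)
  refl φ := le_iInf fun x => (homV V).refl (φ.1 x)
  trans φ φ' φ'' := le_iInf fun x =>
    (mul_le_mul' (iInf_le _ x) (iInf_le _ x)).trans ((homV V).trans (φ.1 x) (φ'.1 x) (φ''.1 x))

/-- `Ω(X)` as a `U`-graph: the exponential `V ^ X` of `U`-graphs. -/
def Omega.ugraph (a : UCat V X) : UGraph V (Omega a) where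
  str 𝔭 φ := ⨅ (𝔮 : Ultrafilter (X × Omega a)) (_ : 𝔮.map Prod.snd = 𝔭) (x : X),
    qhom (a.str (𝔮.map Prod.fst) x) (qhom (xi (𝔮.map fun p => p.2.1 p.1)) (φ.1 x))
  refl φ := by
    refine le_iInf fun 𝔮 => le_iInf fun h𝔮 => le_iInf fun x => ?_
    have hmem : {φ} ∈ 𝔮.map (Prod.snd : X × Omega a → Omega a) := by
      rw [h𝔮]; exact Ultrafilter.mem_pure.2 rfl
    have hmap : (𝔮.map fun p : X × Omega a => p.2.1 p.1) = (𝔮.map Prod.fst).map φ.1 := by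
      apply Ultrafilter.coe_injective
      rw [Ultrafilter.coe_map, Ultrafilter.coe_map, Ultrafilter.coe_map, Filter.map_map]
      refine Filter.map_congr ?_
      filter_upwards [Ultrafilter.mem_map.1 hmem] with p hp
      have hp' : p.2 = φ := hp
      simp [hp']
    rw [le_qhom, one_mul, hmap]
    exact φ.2 _ x

variable (a : UCat V X)

/-- `U`-compatibility of a map `Φ : Ω(X) → V`: for every algebra `I` of the ultrafilter monad,
`Φ ∘ h` is a `U`-graph morphism whenever `h : I → Ω(X)` is one. -/
def UCompatible (Φ : Omega a → V) : Prop :=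
  ∀ (I : Type w) (α : UAlgebra I) (h : I → Omega a),
    IsMorphism (α.toUGraph V) (Omega.ugraph a) h →
      IsMorphism (α.toUGraph V) (homXi V) (Φ ∘ h)

/-- `Φ : Ω(X) → V` preserves suprema of `U`-diagrams, i.e. of `U`-graph morphisms `D : I → Ω(X)`
where `I` is an algebra of the ultrafilter monad. -/
def PreservesUSuprema (Φ : Omega a → V) : Prop :=
  ∀ (I : Type w) (α : UAlgebra I) (D : I → Omega a),
    IsMorphism (α.toUGraph V) (Omega.ugraph a) D →
      ∀ m, IsSupremum (Omega.vcat a) (Set.range D) m →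
        IsSupremum (homV V) (Φ '' Set.range D) (Φ m)

/-- `Φ : Ω(X) → V` is a `V`-functor that preserves infima, tensors and cotensors. -/
structure IsLimitTensorFunctor (Φ : Omega a → V) : Prop where
  functor : IsVFunctor (Omega.vcat a) (homV V) Φ
  infima : PreservesInfima (Omega.vcat a) (homV V) Φ
  tensors : PreservesTensors (Omega.vcat a) (homV V) Φ
  cotensors : PreservesCotensors (Omega.vcat a) (homV V) Φ

/-- Homomorphisms of `U`-frames `Ω(X) → V`: `U`-compatible `V`-functors that preserve weighted limits
(i.e. infima and cotensors) and `U`-weighted colimits (i.e. tensors and `U`-suprema). -/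
structure IsUFrameHom (Φ : Omega a → V) : Prop extends IsLimitTensorFunctor a Φ where
  compatible : UCompatible.{u, v, w} a Φ
  usuprema : PreservesUSuprema.{u, v, w} a Φ

end Omega

section Topological

/-- The two-element chain `Bool`, whose multiplication is conjunction, is a quantale. -/
instance : IsQuantale Bool where
  mul_sSup_distrib x s := by
    cases x
    · exact (eq_bot_iff.2 (iSup₂_le fun _ _ => le_rfl) : (⨆ y ∈ s, (false : Bool) * y) = ⊥).symm
    · simp [Bool.mul_eq_and, sSup_eq_iSup]
  sSup_mul_distrib s x := by
    simp only [mul_comm _ x]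
    cases x
    · exact (eq_bot_iff.2 (iSup₂_le fun _ _ => le_rfl) : (⨆ y ∈ s, (false : Bool) * y) = ⊥).symm
    · simp [Bool.mul_eq_and, sSup_eq_iSup]

theorem xi_bool {𝔵 : Ultrafilter Bool} : xi 𝔵 = true ↔ ({true} : Set Bool) ∈ 𝔵 := by
  constructor
  · intro h
    by_contra hn
    have hf : ({true} : Set Bool)ᶜ ∈ 𝔵 := Ultrafilter.compl_mem_iff_notMem.2 hn
    have h1 := xi_le hf
    rw [h] at h1
    have h2 : sSup (({true} : Set Bool)ᶜ) ≤ false := sSup_le (by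
      intro b hb
      cases b
      · exact le_rfl
      · exact absurd rfl hb)
    exact absurd (h1.trans h2) (by decide)
  · intro h
    refine top_le_iff.1 (le_iInf₂ fun A hA => ?_)
    obtain ⟨b, hb, hb2⟩ := 𝔵.neBot.nonempty_of_mem (inter_mem hA h)
    have hbt : b = true := hb2
    subst hbt
    exact le_sSup hb

/-- The truth value of a proposition. -/
noncomputable def truth (p : Prop) : Bool := @decide p (Classical.propDecidable p)

theorem truth_eq_true {p : Prop} : truth p = true ↔ p := by simp [truth]

/-- A topological space as a category for the classical ultrafilter theory:
`a 𝔵 x` is the truth value of `𝔵` converging to `x`. -/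
noncomputable def ofTop (X : Type u) [TopologicalSpace X] : UCat Bool X where
  str 𝔵 x := truth ((𝔵 : Filter X) ≤ 𝓝 x)
  refl x := top_le_iff.2 (truth_eq_true.2 (pure_le_nhds x))
  trans 𝔵 x := by
    refine iSup_le fun 𝔛 => iSup_le fun h𝔛 => iSup_le fun 𝔶 => Bool.le_iff_imp.2 fun h => ?_
    obtain ⟨hl, hy⟩ := Bool.and_eq_true_iff.1 h
    have hy := truth_eq_true.1 hy
    suffices H : laxExt (fun (𝔵 : Ultrafilter X) x => truth ((𝔵 : Filter X) ≤ 𝓝 x)) 𝔛 𝔶 ≤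
        truth ((𝔵 : Filter X) ≤ 𝓝 x) from Bool.le_iff_imp.1 H hl
    refine iSup_le fun 𝔴 => iSup_le fun h1 => iSup_le fun h2 => Bool.le_iff_imp.2 fun hw => ?_
    rw [xi_bool, Ultrafilter.mem_map] at hw
    refine truth_eq_true.2 fun s hs => ?_
    obtain ⟨O, hOs, hO, hxO⟩ := mem_nhds_iff.1 hs
    refine mem_of_superset ?_ hOs
    have hO2 : O ∈ 𝔴.map Prod.snd := h2 ▸ hy (hO.mem_nhds hxO)
    change O ∈ 𝔵
    rw [← h𝔛, mem_mu, ← h1, Ultrafilter.mem_map]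
    filter_upwards [hw, Ultrafilter.mem_map.1 hO2] with p hp hpO
    exact truth_eq_true.1 hp (hO.mem_nhds hpO)

/-- The characteristic function of a closed set, as an element of `Ω(X)`. -/
noncomputable def ofClosed {X : Type u} [TopologicalSpace X] (C : Closeds X) : Omega (ofTop X) :=
  ⟨fun x => truth (x ∈ C), by
    intro 𝔵 x
    refine Bool.le_iff_imp.2 fun h => top_le_iff.1 (le_qhom.2 (Bool.le_iff_imp.2 fun hm => ?_))
    have hm := (Bool.and_eq_true_iff.1 hm).2
    rw [xi_bool, Ultrafilter.mem_map] at hm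
    have hC : (C : Set X) ∈ 𝔵 := by
      filter_upwards [hm] with y hy
      exact truth_eq_true.1 hy
    exact truth_eq_true.2
      (isClosed_iff_ultrafilter.1 C.isClosed x 𝔵 (truth_eq_true.1 h) hC)⟩

end Topological

section Approach

/-- The quantale `([0, ∞], ≥, +, 0)`; its order is opposite to the usual one. -/
def LawvereQuantale : Type := ENNRealᵒᵈ

noncomputable instance : CompletelyDistribLattice LawvereQuantale :=
  inferInstanceAs (CompletelyDistribLattice ENNRealᵒᵈ)

noncomputable instance : CommMonoid LawvereQuantale :=
  inferInstanceAs (CommMonoid (Multiplicative ENNRealᵒᵈ))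

theorem lawvere_mul_sSup (x : LawvereQuantale) (s : Set LawvereQuantale) :
    x * sSup s = ⨆ y ∈ s, x * y :=
  ENNReal.add_sInf (a := x) (s := s)

instance : IsQuantale LawvereQuantale where
  mul_sSup_distrib := lawvere_mul_sSup
  sSup_mul_distrib s x := by
    simp only [mul_comm _ x]
    exact lawvere_mul_sSup x s

end Approach

end UTheory

open UTheory

namespace UTheory

/-! The general equivalence is a compactness argument. For a diagram `D : I → Ω(X)` and `A ⊆ I`, let
`closureSup D A` be the supremum in `Ω(X)` of the restriction of `D` to `A`; for closed sets it is
the closure of a union. Transitivity of the `U`-category and continuity of the tensor show that it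
is a `U`-functor (`isMorphism_closureSup`) and that, for an ultrafilter `𝔦` on `I`, the infimum of
`closureSup D A` over `A ∈ 𝔦` lies below `D (α 𝔦)` (`iInf_closureSup_le`). Since `Φ` preserves
infima, the same bound holds for the values of `Φ`.

Taking the join over all `𝔦` and applying complete distributivity leaves a choice of one set `g 𝔦 ∈
𝔦` for each `𝔦`. The sets `A` with `Φ (closureSup D A) ≤ ⨆ 𝔦, Φ (closureSup D (g 𝔦))` form an ideal,
because `Φ` preserves finite suprema. This ideal meets every ultrafilter, hence contains `I`, which
bounds `Φ` of the supremum of `D`. Conversely, a finite family is a `U`-diagram on a discrete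
algebra.

Compatibility uses only infima and monotonicity: `Φ` is compared with the infimum of the diagram
over a set of the ultrafilter. The two special cases then amount to verifying the theory and, for
`Bool`, translating the enriched notions into closed sets. -/

theorem TotallyBelow.exists_le_of_le_biSup {V : Type v} [CompleteLattice V] {ι : Sort*}
    {p : ι → Prop} {u v : V} (h : TotallyBelow u v) {f : ι → V} (hf : v ≤ ⨆ (i) (_ : p i), f i) :
    ∃ i, p i ∧ u ≤ f i := by
  obtain ⟨_, ⟨i, hi, rfl⟩, hu⟩ := h {v | ∃ i, p i ∧ f i = v}
    (hf.trans (iSup₂_le fun i hi => le_sSup ⟨i, hi, rfl⟩))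
  exact ⟨i, hi, hu⟩

section Lattice

variable {V : Type v} [CommMonoid V] [CompleteLattice V] [IsQuantale V] {X : Type u}

theorem isMorphism_homXi_iff {a : UGraph V X} {ψ : X → V} :
    IsMorphism a (homXi V) ψ ↔ ∀ 𝔵 x, a.str 𝔵 x * xi (𝔵.map ψ) ≤ ψ x :=
  forall₂_congr fun _ _ => le_qhom

theorem one_le_qhom {y z : V} : 1 ≤ qhom y z ↔ y ≤ z := by
  rw [le_qhom, one_mul]

theorem le_qhom_comm {x y z : V} : x ≤ qhom y z ↔ y ≤ qhom x z := by
  rw [le_qhom, mul_comm, ← le_qhom]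

theorem qhom_one (z : V) : qhom 1 z = z :=
  le_antisymm (by simpa using le_qhom.1 (le_refl (qhom 1 z))) (le_qhom.2 (mul_one z).le)

theorem qhom_iInf {ι : Sort*} (y : V) (f : ι → V) :
    qhom y (⨅ i, f i) = ⨅ i, qhom y (f i) :=
  eq_of_forall_le_iff fun c => by simp only [le_qhom, le_iInf_iff]

theorem UCat.str_mu_ge (a : UCat V X)
    (𝔴 : Ultrafilter (Ultrafilter X × X)) (x : X) :
    xi (𝔴.map fun p => a.str p.1 p.2) * a.str (𝔴.map Prod.snd) x ≤
      a.str (mu (𝔴.map Prod.fst)) x := by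
  refine le_trans ?_ (a.trans _ x)
  refine le_trans (mul_le_mul_left ?_ _)
    (le_iSup₂_of_le (𝔴.map Prod.fst) rfl (le_iSup_of_le (𝔴.map Prod.snd) le_rfl))
  exact le_iSup_of_le 𝔴 (le_iSup₂_of_le rfl rfl le_rfl)

end Lattice

/-! ### Calculus of `xi` by totally below approximation. -/

section Xi

variable {V : Type v} [CompletelyDistribLattice V] {Z : Type u} {Y : Type w}

/-- Distribute the meet, over all `S` with `v ≤ ⋁ S`, of these joins: for each choice function, the
meet of the chosen elements is totally below `v`, so `v` is a join of elements totally below it. -/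
theorem le_of_forall_totallyBelow {v c : V} (h : ∀ u, TotallyBelow u v → u ≤ c) : v ≤ c := by
  have h1 : v ≤ ⨅ S : {S : Set V // v ≤ sSup S}, ⨆ s : S.1, (s : V) :=
    le_iInf fun S => by rw [← sSup_eq_iSup']; exact S.2
  rw [iInf_iSup_eq] at h1
  refine h1.trans (iSup_le fun g => h _ fun S hS => ⟨g ⟨S, hS⟩, (g ⟨S, hS⟩).2, ?_⟩)
  exact iInf_le (fun S : {S : Set V // v ≤ sSup S} => (g S : V)) ⟨S, hS⟩

/-- Together with `le_xi_map`, this turns inequalities about `xi` into membership in an ultrafilter.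
-/
theorem TotallyBelow.setOf_le_mem {u : V} {𝔷 : Ultrafilter Z} {f : Z → V}
    (h : TotallyBelow u (xi (𝔷.map f))) : {z | u ≤ f z} ∈ 𝔷 := by
  by_contra hn
  have hc : {v : V | ¬ u ≤ v} ∈ 𝔷.map f := Ultrafilter.compl_mem_iff_notMem.2 hn
  obtain ⟨s, hs, hus⟩ := h _ (xi_le hc)
  exact hs hus

theorem le_xi_map {u : V} {𝔷 : Ultrafilter Z} {f : Z → V} (h : {z | u ≤ f z} ∈ 𝔷) :
    u ≤ xi (𝔷.map f) := by
  refine le_iInf₂ fun A hA => ?_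
  obtain ⟨z, hz, hzA⟩ := 𝔷.neBot.nonempty_of_mem (inter_mem h hA)
  exact le_trans hz (le_sSup hzA)

theorem xi_map_mono {𝔷 : Ultrafilter Z} {f g : Z → V} (h : {z | f z ≤ g z} ∈ 𝔷) :
    xi (𝔷.map f) ≤ xi (𝔷.map g) :=
  le_of_forall_totallyBelow fun u hu => le_xi_map <| by
    filter_upwards [hu.setOf_le_mem, h] with z h1 h2 using h1.trans h2

theorem xi_pure (x : V) : xi (pure x : Ultrafilter V) = x :=
  (xi_pure_le x).antisymm (le_xi_map (𝔷 := pure x) (f := id) (Ultrafilter.mem_pure.2 le_rfl))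

/-- Half of the law making `xi` an algebra structure for the ultrafilter monad. -/
theorem xi_map_xi_le (𝔷 : Ultrafilter Z) (F : Z → Ultrafilter Y) (f : Y → V) :
    xi (𝔷.map fun z => xi ((F z).map f)) ≤ xi ((𝔷.bind F).map f) := by
  -- Two successive approximations `u ≪ w ≪ ξ(...)`: the bound by `w` holds for almost all `z`, and
  -- `u ≪ w` then passes to the inner ultrafilter.
  refine le_of_forall_totallyBelow fun w hw => le_of_forall_totallyBelow fun u hu => le_xi_map ?_
  change {z | {y | u ≤ f y} ∈ F z} ∈ 𝔷
  filter_upwards [hw.setOf_le_mem] with z hz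
  exact TotallyBelow.setOf_le_mem fun S hS => hu S (le_trans hz hS)

end Xi

/-! ### Closed unions in a `U`-category. -/

section General

variable {V : Type v} [CommMonoid V] [CompletelyDistribLattice V] [IsQuantale V]
  {X : Type u} {I : Type w} (a : UCat V X)

/-- The closure in `X` of the union of the family `D` over `A`. -/
def closureSup (D : I → X → V) (A : Set I) (x : X) : V :=
  ⨆ (𝔮 : Ultrafilter (X × I)) (_ : A ∈ 𝔮.map Prod.snd),
    a.str (𝔮.map Prod.fst) x * xi (𝔮.map fun p => D p.2 p.1)

variable {a}

/-- A closure is closed: for `𝔶`-almost all `y` choose an ultrafilter witnessing the value at `y`,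
and sum these witnesses along an ultrafilter over `𝔶`. Transitivity handles the structure of `X`,
continuity of the tensor the product of the two factors. -/
theorem isMorphism_closureSup (hV : IsUltrafilterTheory V) (D : I → X → V) (A : Set I) :
    IsMorphism a.toUGraph (homXi V) (closureSup a D A) := by
  refine isMorphism_homXi_iff.2 fun 𝔶 x => ?_
  -- Residuation isolates `ξ` on the left, where it can be approximated from totally below.
  rw [mul_comm, ← le_qhom]
  refine le_of_forall_totallyBelow fun w hw => le_of_forall_totallyBelow fun u hu => ?_
  rw [le_qhom]
  let R : Set (Ultrafilter (X × I) × X) := {p | A ∈ p.1.map Prod.snd ∧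
    u ≤ a.str (p.1.map Prod.fst) p.2 * xi (p.1.map fun q => D q.2 q.1)}
  have hR : Prod.snd '' R ∈ 𝔶 := by
    filter_upwards [hw.setOf_le_mem] with y hy
    obtain ⟨𝔮, hA, h𝔮⟩ := hu.exists_le_of_le_biSup hy
    exact ⟨(𝔮, y), ⟨hA, h𝔮⟩, rfl⟩
  -- An ultrafilter of pairs (witness, point) concentrated on `R` and lying over `𝔶`; this avoids
  -- choosing a witness for each point.
  let 𝔷 := Ultrafilter.ofComapInfPrincipal hR
  have h𝔷R : R ∈ 𝔷 := Ultrafilter.ofComapInfPrincipal_mem hR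
  have h𝔷 : 𝔷.map Prod.snd = 𝔶 := Ultrafilter.ofComapInfPrincipal_eq_of_map hR
  have hmul := hV.xi_map_mul (𝔷.map fun p =>
    (a.str (p.1.map Prod.fst) p.2, xi (p.1.map fun q => D q.2 q.1)))
  simp only [Ultrafilter.map_map] at hmul
  have hu' : u ≤ _ := le_xi_map (𝔷 := 𝔷) (mem_of_superset h𝔷R fun p hp => hp.2)
  have hA : A ∈ (𝔷.bind Prod.fst).map Prod.snd := by
    change {p : Ultrafilter (X × I) × X | A ∈ p.1.map Prod.snd} ∈ 𝔷
    exact mem_of_superset h𝔷R fun p hp => hp.1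
  have h1 := a.str_mu_ge (𝔷.map fun p => (p.1.map Prod.fst, p.2)) x
  rw [Ultrafilter.map_map, Ultrafilter.map_map, Ultrafilter.map_map] at h1
  change _ * a.str (𝔷.map Prod.snd) x ≤ a.str ((𝔷.bind Prod.fst).map Prod.fst) x at h1
  rw [h𝔷] at h1
  refine le_trans ?_ (le_iSup₂_of_le (𝔷.bind Prod.fst) hA le_rfl)
  calc u * a.str 𝔶 x
      ≤ (xi (𝔷.map fun p => a.str (p.1.map Prod.fst) p.2) *
          xi (𝔷.map fun p => xi (p.1.map fun q => D q.2 q.1))) * a.str 𝔶 x :=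
        mul_le_mul_left (hu'.trans hmul.le) _
    _ = (xi (𝔷.map fun p => a.str (p.1.map Prod.fst) p.2) * a.str 𝔶 x) *
          xi (𝔷.map fun p => xi (p.1.map fun q => D q.2 q.1)) := mul_right_comm _ _ _
    _ ≤ _ := mul_le_mul' h1 (xi_map_xi_le _ _ _)

theorem le_closureSup (D : I → X → V) {A : Set I} {i : I} (hi : i ∈ A) (x : X) :
    D i x ≤ closureSup a D A x := by
  refine le_trans ?_ (le_iSup₂_of_le (pure (x, i)) hi le_rfl)
  refine le_trans ?_ (mul_le_mul_left (a.refl x) _)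
  rw [one_mul]
  exact (xi_pure _).ge

theorem closureSup_le {D : I → X → V} {A : Set I} {ψ : X → V}
    (hψ : IsMorphism a.toUGraph (homXi V) ψ) (h : ∀ i ∈ A, ∀ x, D i x ≤ ψ x) (x : X) :
    closureSup a D A x ≤ ψ x := by
  refine iSup₂_le fun 𝔮 hA => ?_
  refine le_trans (mul_le_mul_right ?_ _) (isMorphism_homXi_iff.1 hψ _ x)
  rw [Ultrafilter.map_map]
  exact xi_map_mono (mem_of_superset hA fun p hp => h _ hp _)

/-- The closures along an ultrafilter shrink to the points it converges to. -/
theorem iInf_closureSup_le (hV : IsUltrafilterTheory V) {D : I → X → V} {𝔦 : Ultrafilter I}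
    {φ : X → V}
    (h : ∀ 𝔮 : Ultrafilter (X × I), 𝔮.map Prod.snd = 𝔦 → ∀ x,
      a.str (𝔮.map Prod.fst) x * xi (𝔮.map fun p => D p.2 p.1) ≤ φ x) (x : X) :
    ⨅ A ∈ 𝔦, closureSup a D A x ≤ φ x := by
  refine le_of_forall_totallyBelow fun u hu => ?_
  let R : Set (Ultrafilter (X × I)) :=
    {𝔮 | u ≤ a.str (𝔮.map Prod.fst) x * xi (𝔮.map fun p => D p.2 p.1)}
  -- `T A` collects the witnesses for `u` living over `A`. An ultrafilter `𝔔` containing every `T A`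
  -- has a sum `mu 𝔔` lying over `𝔦`, to which `h` applies.
  let T : Set I → Set (Ultrafilter (X × I)) := fun A => {𝔮 | A ∈ 𝔮.map Prod.snd ∧ 𝔮 ∈ R}
  have hT : Monotone T := fun A B hAB 𝔮 h𝔮 => ⟨mem_of_superset h𝔮.1 hAB, h𝔮.2⟩
  have hne : ((𝔦 : Filter I).lift' T).NeBot := by
    rw [lift'_neBot_iff hT]
    intro A hA
    obtain ⟨𝔮, hq⟩ := hu.exists_le_of_le_biSup (iInf₂_le A hA)
    exact ⟨𝔮, hq⟩
  let 𝔔 := Ultrafilter.of ((𝔦 : Filter I).lift' T)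
  have h𝔔 : ∀ A ∈ 𝔦, T A ∈ 𝔔 := fun A hA => Ultrafilter.of_le _ (mem_lift' hA)
  have hsnd : (mu 𝔔).map Prod.snd = 𝔦 := by
    refine Ultrafilter.eq_of_le fun A hA => ?_
    change {𝔮 : Ultrafilter (X × I) | A ∈ 𝔮.map Prod.snd} ∈ 𝔔
    exact mem_of_superset (h𝔔 A hA) fun 𝔮 h𝔮 => h𝔮.1
  have hu' : u ≤ _ := le_xi_map (𝔷 := 𝔔) (mem_of_superset (h𝔔 _ univ_mem) fun p hp => hp.2)
  have hmul := hV.xi_map_mul (𝔔.map fun 𝔮 =>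
    (a.str (𝔮.map Prod.fst) x, xi (𝔮.map fun q => D q.2 q.1)))
  rw [Ultrafilter.map_map, Ultrafilter.map_map, Ultrafilter.map_map] at hmul
  have h1 := a.str_mu_ge (𝔔.map fun 𝔮 => (𝔮.map Prod.fst, x)) x
  rw [Ultrafilter.map_map, Ultrafilter.map_map, Ultrafilter.map_map] at h1
  change _ * a.str (𝔔.map fun _ => x) x ≤ a.str ((mu 𝔔).map Prod.fst) x at h1
  -- All witnesses approximate the same `x`, so transitivity is used with the principal ultrafilter
  -- as middle term, and reflexivity absorbs its factor.
  have hconst : (𝔔.map fun _ => x) = pure x := by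
    apply Ultrafilter.coe_injective
    rw [Ultrafilter.coe_map]
    exact Filter.map_const
  rw [hconst] at h1
  refine (hu'.trans hmul.le).trans (le_trans (mul_le_mul' ?_ ?_) (h (mu 𝔔) hsnd x))
  · refine le_trans ?_ h1
    refine le_trans ?_ (mul_le_mul_right (a.refl x) _)
    exact (mul_one _).ge
  · exact xi_map_xi_le 𝔔 id _

end General

/-! ### Finite discrete algebras. -/

/-- The discrete algebra on a finite set. -/
noncomputable def UAlgebra.ofFinite (I : Type w) [Finite I] : UAlgebra I where
  str 𝔦 := (Ultrafilter.eq_pure_of_finite 𝔦).choose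
  str_pure i := (Ultrafilter.pure_injective
    (Ultrafilter.eq_pure_of_finite (pure i : Ultrafilter I)).choose_spec).symm
  str_map_str 𝔍 := by
    suffices h : 𝔍.map (fun 𝔦 => (Ultrafilter.eq_pure_of_finite 𝔦).choose) = mu 𝔍 by
      simp only [h]
    refine Ultrafilter.eq_of_le fun A hA => ?_
    change {i : Ultrafilter I | (Ultrafilter.eq_pure_of_finite i).choose ∈ A} ∈ 𝔍
    have hA' : {i : Ultrafilter I | A ∈ i} ∈ 𝔍 := hA
    refine mem_of_superset hA' fun i hi => ?_
    rw [Set.mem_ofPred_eq, (Ultrafilter.eq_pure_of_finite i).choose_spec] at hi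
    exact hi

theorem UAlgebra.pure_ofFinite_str {I : Type w} [Finite I] (𝔦 : Ultrafilter I) :
    pure ((UAlgebra.ofFinite I).str 𝔦) = 𝔦 :=
  (Ultrafilter.eq_pure_of_finite 𝔦).choose_spec.symm

/-- All ultrafilters on `I` are principal, so reflexivity of `b` is all that is needed. -/
theorem UAlgebra.isMorphism_ofFinite {V : Type v} [CommMonoid V] [CompleteLattice V]
    {I : Type w} [Finite I] {Y : Type u} (b : UGraph V Y)
    (h : I → Y) : IsMorphism ((UAlgebra.ofFinite I).toUGraph V) b h := by
  intro 𝔦 i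
  refine iSup_le fun hi => ?_
  rw [← UAlgebra.pure_ofFinite_str 𝔦, hi]
  exact b.refl (h i)

/-! ### Enriched limits and colimits in `V` and in `Ω(X)`. -/

section VCategorical

variable {V : Type v} [CommMonoid V] [CompleteLattice V] [IsQuantale V]

theorem isInfimum_homV_iff {S : Set V} {m : V} : IsInfimum (homV V) S m ↔ m = sInf S := by
  constructor
  · intro h
    have h1 := h 1
    change qhom 1 m = ⨅ s ∈ S, qhom 1 s at h1
    simpa only [qhom_one, ← sInf_eq_iInf] using h1
  · rintro rfl y
    change qhom y (sInf S) = ⨅ s ∈ S, qhom y s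
    simp only [sInf_eq_iInf, qhom_iInf]

theorem isSupremum_homV_iff {S : Set V} {m : V} : IsSupremum (homV V) S m ↔ m = sSup S := by
  constructor
  · intro h
    refine eq_of_forall_ge_iff fun y => ?_
    have h1 : qhom m y = ⨅ s ∈ S, qhom s y := h y
    rw [← one_le_qhom, h1, sSup_le_iff]
    simp only [le_iInf_iff, one_le_qhom]
  · rintro rfl y
    change qhom (sSup S) y = ⨅ s ∈ S, qhom s y
    refine eq_of_forall_le_iff fun c => ?_
    rw [le_qhom_comm, sSup_le_iff]
    simp only [le_iInf_iff, le_qhom_comm (x := c)]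

variable {X : Type u} {a : UCat V X}

theorem Omega.one_le_hom_iff {φ ψ : Omega a} :
    1 ≤ (Omega.vcat a).hom φ ψ ↔ ∀ x, φ.1 x ≤ ψ.1 x := by
  simp only [Omega.vcat, le_iInf_iff, one_le_qhom]

theorem Omega.isInfimum_of_forall_eq {S : Set (Omega a)} {m : Omega a}
    (h : ∀ x, m.1 x = ⨅ s ∈ S, s.1 x) : IsInfimum (Omega.vcat a) S m := by
  intro y
  refine eq_of_forall_le_iff fun c => ?_
  simp only [Omega.vcat, le_iInf_iff, h, qhom_iInf]
  exact ⟨fun h s hs x => h x s hs, fun h x s hs => h s hs x⟩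

/-- The pointwise infimum of a set of `U`-functors into `V`. -/
theorem Omega.exists_infimum (S : Set (Omega a)) :
    ∃ m : Omega a, ∀ x, m.1 x = ⨅ s ∈ S, s.1 x := by
  refine ⟨⟨fun x => ⨅ s ∈ S, s.1 x, isMorphism_homXi_iff.2 fun 𝔵 x => ?_⟩, fun _ => rfl⟩
  refine le_iInf₂ fun s hs => le_trans (mul_le_mul_right ?_ _) (isMorphism_homXi_iff.1 s.2 𝔵 x)
  refine le_iInf₂ fun A hA => ?_
  refine (xi_le (A := (fun x => ⨅ s ∈ S, s.1 x) '' (s.1 ⁻¹' A)) ?_).trans (sSup_le ?_)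
  · exact Filter.image_mem_map (Ultrafilter.mem_map.1 hA)
  · rintro _ ⟨y, hy, rfl⟩
    exact (iInf₂_le s hs).trans (le_sSup hy)

theorem Omega.map_le_map {Φ : Omega a → V} (hΦ : IsVFunctor (Omega.vcat a) (homV V) Φ)
    {φ ψ : Omega a} (h : ∀ x, φ.1 x ≤ ψ.1 x) : Φ φ ≤ Φ ψ :=
  one_le_qhom.1 ((Omega.one_le_hom_iff.2 h).trans (hΦ φ ψ))

theorem IsSupremum.le_iff {S : Set (Omega a)} {m : Omega a} (h : IsSupremum (Omega.vcat a) S m)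
    {y : Omega a} : (∀ x, m.1 x ≤ y.1 x) ↔ ∀ s ∈ S, ∀ x, s.1 x ≤ y.1 x := by
  rw [← Omega.one_le_hom_iff, h y]
  simp only [le_iInf_iff, Omega.one_le_hom_iff]

/-- The morphism condition at `𝔦` and its limit `α.str 𝔦`, evaluated at the image of `𝔮` under `id ×
D`. -/
theorem IsMorphism.mul_xi_le {I : Type w} {α : UAlgebra I} {D : I → Omega a}
    (hD : IsMorphism (α.toUGraph V) (Omega.ugraph a) D) {𝔦 : Ultrafilter I}
    {𝔮 : Ultrafilter (X × I)} (h𝔮 : 𝔮.map Prod.snd = 𝔦) (x : X) :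
    a.str (𝔮.map Prod.fst) x * xi (𝔮.map fun p => (D p.2).1 p.1) ≤ (D (α.str 𝔦)).1 x := by
  have h1 : (1 : V) ≤ (Omega.ugraph a).str (𝔦.map D) (D (α.str 𝔦)) :=
    (le_iSup_of_le rfl le_rfl).trans (hD 𝔦 (α.str 𝔦))
  have h2 := h1.trans (iInf₂_le_of_le (𝔮.map fun p => (p.1, D p.2)) (by
    rw [Ultrafilter.map_map, ← h𝔮, Ultrafilter.map_map]; rfl) (iInf_le _ x))
  rw [one_le_qhom, le_qhom] at h2
  simpa only [Ultrafilter.map_map, Function.comp_def] using h2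

theorem PreservesUSuprema.preservesFiniteSuprema {Φ : Omega a → V}
    (h : PreservesUSuprema.{u, v, w} a Φ) :
    PreservesFiniteSuprema (Omega.vcat a) (homV V) Φ := by
  intro S hS m hm
  obtain ⟨n, f, hf⟩ := hS.fin_param
  have hr : Set.range (fun i : ULift.{w} (Fin n) => f i.down) = S := by
    rw [← hf.2]
    ext y
    simp
  rw [← hr] at hm ⊢
  exact h _ (UAlgebra.ofFinite _) _ (UAlgebra.isMorphism_ofFinite _ _) m hm

end VCategorical

/-! ### Compatibility and preservation of `U`-suprema. -/

section Main

variable {V : Type v} [CommMonoid V] [CompletelyDistribLattice V] [IsQuantale V]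
  {X : Type u} {a : UCat V X}

theorem IsInfimum.eq_sInf_image {Φ : Omega a → V}
    (hinf : PreservesInfima (Omega.vcat a) (homV V) Φ) {S : Set (Omega a)} {m : Omega a}
    (h : ∀ x, m.1 x = ⨅ s ∈ S, s.1 x) : Φ m = sInf (Φ '' S) :=
  isInfimum_homV_iff.1 (hinf _ _ (Omega.isInfimum_of_forall_eq h))

/-- If `u ≤ Φ (h j)` for almost all `j`, the infimum of these `h j` lies below `h i`, and `Φ` of
that infimum is still above `u`. -/
theorem uCompatible_of_preservesInfima {Φ : Omega a → V}
    (hfun : IsVFunctor (Omega.vcat a) (homV V) Φ)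
    (hinf : PreservesInfima (Omega.vcat a) (homV V) Φ) : UCompatible.{u, v, w} a Φ := by
  intro I α h hh 𝔦 i
  refine iSup_le fun hi => one_le_qhom.2 ?_
  refine le_of_forall_totallyBelow fun u hu => ?_
  let A : Set I := {j | u ≤ Φ (h j)}
  have hA : A ∈ 𝔦 := hu.setOf_le_mem
  obtain ⟨m, hm⟩ := Omega.exists_infimum (h '' A)
  have hmi : ∀ x, m.1 x ≤ (h i).1 x := by
    intro x
    -- Placing `𝔦` on the slice `{x} × I` gives pointwise convergence at `x`.
    have h1 := hh.mul_xi_le (𝔦 := 𝔦) (𝔮 := 𝔦.map fun j => (x, j)) (by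
      rw [Ultrafilter.map_map]; exact Ultrafilter.map_id _) x
    rw [Ultrafilter.map_map, Ultrafilter.map_map, hi] at h1
    have hconst : 𝔦.map (Prod.fst ∘ fun j => (x, j)) = pure x := by
      apply Ultrafilter.coe_injective
      rw [Ultrafilter.coe_map]
      exact Filter.map_const
    rw [hconst] at h1
    refine le_trans ?_ h1
    rw [hm]
    refine le_trans ?_ (mul_le_mul_left (a.refl x) _)
    rw [one_mul]
    exact le_xi_map (mem_of_superset hA fun j hj => iInf₂_le (h j) ⟨j, hj, rfl⟩)
  refine le_trans ?_ (Omega.map_le_map hfun hmi)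
  rw [IsInfimum.eq_sInf_image hinf hm]
  refine le_sInf ?_
  rintro _ ⟨_, ⟨j, hj, rfl⟩, rfl⟩
  exact hj

/-- A least upper bound in `Ω(X)` is a conical supremum. -/
theorem Omega.isSupremum_of_isLeast {S : Set (Omega a)} {m : Omega a}
    (hub : ∀ s ∈ S, ∀ x, s.1 x ≤ m.1 x)
    (hlub : ∀ ψ : Omega a, (∀ s ∈ S, ∀ x, s.1 x ≤ ψ.1 x) → ∀ x, m.1 x ≤ ψ.1 x) :
    IsSupremum (Omega.vcat a) S m := by
  intro y
  refine eq_of_forall_le_iff fun c => ?_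
  simp only [Omega.vcat, le_iInf_iff, le_qhom]
  constructor
  · exact fun h s hs x => (mul_le_mul_right (hub s hs x) _).trans (h x)
  · intro h x
    rw [mul_comm, ← le_qhom]
    -- The cotensor of `y` with `c` is again a `U`-functor; testing the order-theoretic least upper
    -- bound against it gives the enriched universal property.
    refine hlub ⟨fun x => qhom c (y.1 x), isMorphism_homXi_iff.2 fun 𝔵 x => ?_⟩
      (fun s hs x => by rw [le_qhom, mul_comm]; exact h s hs x) x
    rw [le_qhom, mul_assoc]
    refine le_trans (mul_le_mul_right ?_ _) (isMorphism_homXi_iff.1 y.2 𝔵 x)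
    rw [← le_qhom]
    refine le_of_forall_totallyBelow fun u hu => ?_
    rw [le_qhom]
    exact le_xi_map (mem_of_superset hu.setOf_le_mem fun z hz => le_qhom.1 hz)

/-- The supremum in `Ω(X)` of the restriction of a family to a set of indices. -/
def Omega.closureSup (hV : IsUltrafilterTheory V) {I : Type w} (D : I → Omega a) (A : Set I) :
    Omega a :=
  ⟨UTheory.closureSup a (fun i => (D i).1) A, isMorphism_closureSup hV _ A⟩

theorem Omega.closureSup_le_iff (hV : IsUltrafilterTheory V) {I : Type w} {D : I → Omega a}
    {A : Set I} {ψ : Omega a} :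
    (∀ x, (Omega.closureSup hV D A).1 x ≤ ψ.1 x) ↔ ∀ i ∈ A, ∀ x, (D i).1 x ≤ ψ.1 x := by
  constructor
  · intro h i hi x
    exact (le_closureSup (a := a) (fun i => (D i).1) hi x).trans (h x)
  · intro h x
    exact closureSup_le (D := fun i => (D i).1) ψ.2 h x

theorem map_closureSup_union (hV : IsUltrafilterTheory V) {Φ : Omega a → V}
    (hfin : PreservesFiniteSuprema (Omega.vcat a) (homV V) Φ) {I : Type w} (D : I → Omega a)
    (A B : Set I) :
    Φ (Omega.closureSup hV D (A ∪ B)) =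
      Φ (Omega.closureSup hV D A) ⊔ Φ (Omega.closureSup hV D B) := by
  have h := hfin {Omega.closureSup hV D A, Omega.closureSup hV D B} (by simp)
    (Omega.closureSup hV D (A ∪ B)) (Omega.isSupremum_of_isLeast ?_ ?_)
  · rw [isSupremum_homV_iff.1 h, Set.image_pair, sSup_pair]
  · have h0 := (Omega.closureSup_le_iff (a := a) hV (D := D) (A := A ∪ B)).1 fun _ => le_rfl
    rintro s (rfl | rfl)
    · exact (Omega.closureSup_le_iff hV).2 fun i hi => h0 i (Or.inl hi)
    · exact (Omega.closureSup_le_iff hV).2 fun i hi => h0 i (Or.inr hi)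
  · intro ψ hψ
    refine (Omega.closureSup_le_iff hV).2 ?_
    rintro i (hi | hi)
    · exact (Omega.closureSup_le_iff hV).1 (hψ _ (Or.inl rfl)) i hi
    · exact (Omega.closureSup_le_iff hV).1 (hψ _ (Or.inr rfl)) i hi

theorem map_closureSup_empty (hV : IsUltrafilterTheory V) {Φ : Omega a → V}
    (hfin : PreservesFiniteSuprema (Omega.vcat a) (homV V) Φ) {I : Type w} (D : I → Omega a) :
    Φ (Omega.closureSup hV D ∅) = ⊥ := by
  have h := hfin ∅ Set.finite_empty (Omega.closureSup hV D ∅) (Omega.isSupremum_of_isLeast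
    (by simp) fun ψ _ => (Omega.closureSup_le_iff hV).2 (by simp))
  simpa using isSupremum_homV_iff.1 h

/-- An ideal of subsets of `I` that meets every ultrafilter contains `I`. -/
theorem univ_of_forall_ultrafilter {I : Type w} {p : Set I → Prop} (h0 : p ∅)
    (hmono : ∀ A, p A → ∀ B ⊆ A, p B) (hunion : ∀ A, p A → ∀ B, p B → p (A ∪ B))
    (h : ∀ 𝔦 : Ultrafilter I, ∃ A ∈ 𝔦, p A) : p Set.univ := by
  by_contra hn
  -- If `I` is not in the ideal, the complements of its members form a proper filter, and an
  -- ultrafilter refining it misses the ideal.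
  have hne : (Filter.comk p h0 hmono hunion).NeBot := by
    refine ⟨fun hb => hn ?_⟩
    have : (∅ : Set I) ∈ Filter.comk p h0 hmono hunion := hb ▸ mem_bot
    simpa [Filter.mem_comk] using this
  obtain ⟨A, hA, hpA⟩ := h (Ultrafilter.of (Filter.comk p h0 hmono hunion))
  have hc : Aᶜ ∈ Ultrafilter.of (Filter.comk p h0 hmono hunion) :=
    Ultrafilter.of_le _ (by simpa [Filter.mem_comk] using hpA)
  exact Ultrafilter.compl_notMem_iff.2 hA hc

theorem iInf_map_closureSup_le (hV : IsUltrafilterTheory V) {Φ : Omega a → V}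
    (hfun : IsVFunctor (Omega.vcat a) (homV V) Φ)
    (hinf : PreservesInfima (Omega.vcat a) (homV V) Φ) {I : Type w} {α : UAlgebra I}
    {D : I → Omega a} (hD : IsMorphism (α.toUGraph V) (Omega.ugraph a) D) (𝔦 : Ultrafilter I) :
    ⨅ A : {A : Set I // A ∈ 𝔦}, Φ (Omega.closureSup hV D A) ≤ Φ (D (α.str 𝔦)) := by
  obtain ⟨l, hl⟩ := Omega.exists_infimum
    (Set.range fun A : {A : Set I // A ∈ 𝔦} => Omega.closureSup hV D A)
  have hle : ∀ x, l.1 x ≤ (D (α.str 𝔦)).1 x := by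
    intro x
    have h1 := iInf_closureSup_le (D := fun i => (D i).1) (φ := (D (α.str 𝔦)).1) hV
      (fun 𝔮 h𝔮 x => hD.mul_xi_le h𝔮 x) x
    refine le_trans (le_iInf₂ fun A hA => ?_) h1
    rw [hl]
    exact iInf₂_le (Omega.closureSup hV D A) ⟨⟨A, hA⟩, rfl⟩
  refine le_trans ?_ (Omega.map_le_map hfun hle)
  rw [IsInfimum.eq_sInf_image hinf hl, ← Set.range_comp]
  exact le_rfl

/-- Complete distributivity turns the bounds along ultrafilters into a covering problem, and
compactness of the space of ultrafilters on `I` reduces it to finite suprema. -/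
theorem preservesUSuprema_of_preservesFiniteSuprema (hV : IsUltrafilterTheory V)
    {Φ : Omega a → V} (hfun : IsVFunctor (Omega.vcat a) (homV V) Φ)
    (hinf : PreservesInfima (Omega.vcat a) (homV V) Φ)
    (hfin : PreservesFiniteSuprema (Omega.vcat a) (homV V) Φ) :
    PreservesUSuprema.{u, v, w} a Φ := by
  intro I α D hD m hm
  rw [isSupremum_homV_iff]
  refine le_antisymm ?_ (sSup_le ?_)
  · have key : ∀ 𝔦 : Ultrafilter I,
        ⨅ A : {A : Set I // A ∈ 𝔦}, Φ (Omega.closureSup hV D A) ≤ sSup (Φ '' Set.range D) := by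
      intro 𝔦
      exact (iInf_map_closureSup_le hV hfun hinf hD 𝔦).trans (le_sSup ⟨_, ⟨_, rfl⟩, rfl⟩)
    refine le_trans ?_ (iSup_le key)
    -- From here `g` picks one member of every ultrafilter, and only the ideal property of the
    -- bounded index sets is needed.
    rw [iSup_iInf_eq]
    refine le_iInf fun g => ?_
    have huniv : Φ (Omega.closureSup hV D Set.univ) ≤
        ⨆ 𝔦 : Ultrafilter I, Φ (Omega.closureSup hV D (g 𝔦)) :=
      univ_of_forall_ultrafilter (p := fun A => Φ (Omega.closureSup hV D A) ≤
          ⨆ 𝔦 : Ultrafilter I, Φ (Omega.closureSup hV D (g 𝔦)))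
        ((map_closureSup_empty hV hfin D).le.trans bot_le)
        (fun A hA B hBA => le_trans (Omega.map_le_map hfun ((Omega.closureSup_le_iff hV).2
          fun i hi => (Omega.closureSup_le_iff hV).1 (fun _ => le_rfl) i (hBA hi))) hA)
        (fun A hA B hB => (map_closureSup_union hV hfin D A B).le.trans (sup_le hA hB))
        (fun 𝔦 => ⟨g 𝔦, (g 𝔦).2,
          le_iSup (fun 𝔦 : Ultrafilter I => Φ (Omega.closureSup hV D (g 𝔦))) 𝔦⟩)
    refine le_trans (Omega.map_le_map hfun (hm.le_iff.2 ?_)) huniv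
    rintro _ ⟨i, rfl⟩
    exact (Omega.closureSup_le_iff hV).1 (fun _ => le_rfl) i trivial
  · rintro _ ⟨s, hs, rfl⟩
    exact Omega.map_le_map hfun (hm.le_iff.1 (fun _ => le_rfl) s hs)

theorem preservesUSuprema_iff (hV : IsUltrafilterTheory V)
    {Φ : Omega a → V} (hfun : IsVFunctor (Omega.vcat a) (homV V) Φ)
    (hinf : PreservesInfima (Omega.vcat a) (homV V) Φ) :
    PreservesUSuprema.{u, v, w} a Φ ↔ PreservesFiniteSuprema (Omega.vcat a) (homV V) Φ :=
  ⟨fun h => h.preservesFiniteSuprema, preservesUSuprema_of_preservesFiniteSuprema hV hfun hinf⟩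

theorem isUFrameHom_iff (hV : IsUltrafilterTheory V) {Φ : Omega a → V} :
    IsUFrameHom.{u, v, w} a Φ ↔
      IsLimitTensorFunctor a Φ ∧ PreservesFiniteSuprema (Omega.vcat a) (homV V) Φ :=
  ⟨fun h => ⟨h.toIsLimitTensorFunctor, h.usuprema.preservesFiniteSuprema⟩, fun h =>
    { h.1 with
      compatible := uCompatible_of_preservesInfima h.1.functor h.1.infima
      usuprema := (preservesUSuprema_iff hV h.1.functor h.1.infima).2 h.2 }⟩

end Main

/-! ### Closed sets of a topological space. -/

section Topological

theorem isUltrafilterTheory_bool : IsUltrafilterTheory Bool where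
  one_eq_top := rfl
  xi_map_mul 𝔴 := by
    rw [Bool.eq_iff_iff, Bool.mul_eq_and, Bool.and_eq_true_iff, xi_bool, xi_bool, xi_bool,
      Ultrafilter.mem_map, Ultrafilter.mem_map, Ultrafilter.mem_map]
    refine Iff.trans ?_ (Filter.inter_mem_iff (f := (𝔴 : Filter (Bool × Bool))))
    refine iff_of_eq (congrArg (· ∈ (𝔴 : Filter (Bool × Bool))) ?_)
    ext p
    simp [Bool.mul_eq_and]

variable {X : Type u} [TopologicalSpace X]

theorem ofClosed_apply {C : Closeds X} {x : X} : (ofClosed C).1 x = true ↔ x ∈ C :=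
  truth_eq_true

theorem ofClosed_le_iff {C D : Closeds X} :
    (∀ x, (ofClosed C).1 x ≤ (ofClosed D).1 x) ↔ C ≤ D := by
  simp only [Bool.le_iff_imp, ofClosed_apply]
  exact Iff.rfl

theorem ofClosed_bijective : Function.Bijective (ofClosed : Closeds X → Omega (ofTop X)) := by
  constructor
  · intro C D h
    exact le_antisymm (ofClosed_le_iff.1 fun x => (congrArg (fun φ => φ.1 x) h).le)
      (ofClosed_le_iff.1 fun x => (congrArg (fun φ => φ.1 x) h).ge)
  · intro φ
    have hc : IsClosed {x | φ.1 x = true} := by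
      rw [isClosed_iff_ultrafilter]
      intro x 𝔵 hx h𝔵
      have h1 := isMorphism_homXi_iff.1 φ.2 𝔵 x
      refine Bool.le_iff_imp.1 h1 (Bool.and_eq_true_iff.2 ⟨truth_eq_true.2 hx, ?_⟩)
      rw [xi_bool]
      exact h𝔵
    refine ⟨⟨_, hc⟩, Subtype.ext (funext fun x => Bool.eq_iff_iff.2 ?_)⟩
    exact ofClosed_apply

theorem ofClosed_hom_eq_true_iff {C D : Closeds X} :
    (Omega.vcat (ofTop X)).hom (ofClosed C) (ofClosed D) = true ↔ C ≤ D := by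
  rw [← ofClosed_le_iff, ← Omega.one_le_hom_iff]
  exact top_le_iff.symm

theorem ofClosed_sInf_apply (S : Set (Closeds X)) (x : X) :
    (ofClosed (sInf S)).1 x = ⨅ s ∈ ofClosed '' S, s.1 x := by
  refine eq_of_forall_le_iff fun c => ?_
  cases c
  · exact iff_of_true bot_le bot_le
  · simp only [le_iInf_iff, Bool.le_iff_imp, ofClosed_apply, forall_const, Set.forall_mem_image,
      Closeds.mem_sInf]

theorem ofClosed_isSupremum_sup (C D : Closeds X) :
    IsSupremum (Omega.vcat (ofTop X)) {ofClosed C, ofClosed D} (ofClosed (C ⊔ D)) := by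
  refine Omega.isSupremum_of_isLeast ?_ fun ψ hψ => ?_
  · rintro s (rfl | rfl)
    · exact ofClosed_le_iff.2 le_sup_left
    · exact ofClosed_le_iff.2 le_sup_right
  · obtain ⟨E, rfl⟩ := ofClosed_bijective.2 ψ
    exact ofClosed_le_iff.2 (sup_le (ofClosed_le_iff.1 (hψ _ (Or.inl rfl)))
      (ofClosed_le_iff.1 (hψ _ (Or.inr rfl))))

theorem ofClosed_isSupremum_bot :
    IsSupremum (Omega.vcat (ofTop X)) ∅ (ofClosed ⊥) := by
  refine Omega.isSupremum_of_isLeast (by simp) fun ψ _ => ?_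
  obtain ⟨E, rfl⟩ := ofClosed_bijective.2 ψ
  exact ofClosed_le_iff.2 bot_le

theorem qhom_bool_iff {r s : Bool} : qhom r s = true ↔ (r = true → s = true) := by
  rw [← Bool.le_iff_imp, ← one_le_qhom]
  exact top_le_iff.symm

/-- Over `Bool` the enrichment is just an order: tensor and cotensor with `true` are the identity,
while with `false` they are the least and the greatest element, which are the empty supremum and the
empty infimum. -/
theorem isUFrameHom_ofTop_iff {Φ : Omega (ofTop X) → Bool} :
    IsUFrameHom.{u, 0, w} (ofTop X) Φ ↔
      (∀ S : Set (Closeds X), Φ (ofClosed (sInf S)) = sInf ((fun C => Φ (ofClosed C)) '' S)) ∧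
      Φ (ofClosed ⊥) = ⊥ ∧
      ∀ C D : Closeds X, Φ (ofClosed (C ⊔ D)) = Φ (ofClosed C) ⊔ Φ (ofClosed D) := by
  rw [isUFrameHom_iff isUltrafilterTheory_bool]
  constructor
  · rintro ⟨hΦ, hfin⟩
    refine ⟨fun S => ?_, ?_, fun C D => ?_⟩
    · rw [IsInfimum.eq_sInf_image hΦ.infima (ofClosed_sInf_apply S), Set.image_image]
    · simpa using isSupremum_homV_iff.1 (hfin _ Set.finite_empty _ ofClosed_isSupremum_bot)
    · have h := isSupremum_homV_iff.1 (hfin _ (by simp) _ (ofClosed_isSupremum_sup C D))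
      rwa [Set.image_pair, sSup_pair] at h
  · rintro ⟨hinf, hbot, hsup⟩
    have hmono : ∀ φ ψ : Omega (ofTop X), (∀ x, φ.1 x ≤ ψ.1 x) → Φ φ ≤ Φ ψ := by
      intro φ ψ h
      obtain ⟨C, rfl⟩ := ofClosed_bijective.2 φ
      obtain ⟨D, rfl⟩ := ofClosed_bijective.2 ψ
      have h1 := hsup C D
      rw [sup_eq_right.2 (ofClosed_le_iff.1 h)] at h1
      exact sup_eq_right.1 h1.symm
    have hanti : ∀ φ ψ : Omega (ofTop X), (∀ x, φ.1 x ≤ ψ.1 x) → (∀ x, ψ.1 x ≤ φ.1 x) →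
        φ = ψ := fun φ ψ h h' => Subtype.ext (funext fun x => le_antisymm (h x) (h' x))
    have htop : Φ (ofClosed ⊤) = true := by simpa using hinf ∅
    have hself : ∀ φ : Omega (ofTop X), (Omega.vcat (ofTop X)).hom φ φ = true :=
      fun φ => top_le_iff.1 ((Omega.vcat (ofTop X)).refl φ)
    have hone : ∀ {φ ψ : Omega (ofTop X)}, (Omega.vcat (ofTop X)).hom φ ψ = true →
      ∀ x, φ.1 x ≤ ψ.1 x := fun h => Omega.one_le_hom_iff.1 h.ge
    refine ⟨⟨fun φ ψ => ?_, fun S m hm => ?_, fun r φ t ht => ?_, fun r φ t ht => ?_⟩,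
      fun S hS m hm => ?_⟩
    · refine Bool.le_iff_imp.2 fun h => top_le_iff.1 (one_le_qhom.2 (hmono _ _ (hone h)))
    · obtain ⟨T, rfl⟩ : ∃ T : Set (Closeds X), ofClosed '' T = S :=
        ⟨ofClosed ⁻¹' S, Set.image_preimage_eq _ ofClosed_bijective.2⟩
      have hm' : m = ofClosed (sInf T) := by
        have h0 := Omega.isInfimum_of_forall_eq (ofClosed_sInf_apply T)
        exact hanti _ _ (hone (by rw [h0 m, ← hm m]; exact hself m))
          (hone (by rw [hm, ← h0]; exact hself _))
      rw [isInfimum_homV_iff, hm', hinf, Set.image_image]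
    · intro y
      cases r
      · have : t = ofClosed ⊥ := by
          refine hanti _ _ (hone ?_) (fun x => ?_)
          · rw [ht, qhom_bool_iff]; simp
          · obtain ⟨E, rfl⟩ := ofClosed_bijective.2 t
            exact ofClosed_le_iff.2 bot_le x
        rw [this, hbot, Bool.eq_iff_iff]
        simp [homV, qhom_bool_iff]
      · have : t = φ := by
          refine hanti _ _ (hone ?_) (hone ?_)
          · rw [ht, qhom_bool_iff]; exact fun _ => hself φ
          · have h1 := (ht t).symm.trans (hself t)
            exact qhom_bool_iff.1 h1 rfl
        rw [this]
        exact (qhom_one _).symm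
    · intro y
      cases r
      · have : t = ofClosed ⊤ := by
          refine hanti _ _ (fun x => ?_) (hone ?_)
          · obtain ⟨E, rfl⟩ := ofClosed_bijective.2 t
            exact ofClosed_le_iff.2 le_top x
          · rw [ht, qhom_bool_iff]; simp
        rw [this, htop, Bool.eq_iff_iff]
        simp [homV, qhom_bool_iff]
      · have : t = φ := by
          refine hanti _ _ (hone ?_) (hone ?_)
          · have h1 := (ht t).symm.trans (hself t)
            exact qhom_bool_iff.1 h1 rfl
          · rw [ht, qhom_bool_iff]; exact fun _ => hself φ
        rw [this]
        exact (qhom_one _).symm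
    · rw [isSupremum_homV_iff]
      refine le_antisymm ?_ (sSup_le ?_)
      · have hS' : ∃ C : Closeds X, (∀ s ∈ S, ∀ x, s.1 x ≤ (ofClosed C).1 x) ∧
            Φ (ofClosed C) ≤ sSup (Φ '' S) := by
          clear hm
          induction S, hS using Set.Finite.induction_on with
          | empty => exact ⟨⊥, by simp, by rw [hbot]; exact bot_le⟩
          | @insert s S _ _ ih =>
            obtain ⟨C, h1, h2⟩ := ih
            obtain ⟨D, rfl⟩ := ofClosed_bijective.2 s
            refine ⟨D ⊔ C, ?_, ?_⟩
            · rintro s (rfl | hs) x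
              · exact ofClosed_le_iff.2 le_sup_left x
              · exact (h1 s hs x).trans (ofClosed_le_iff.2 le_sup_right x)
            · rw [hsup, Set.image_insert_eq, sSup_insert]
              exact sup_le_sup_left h2 _
        obtain ⟨C, h1, h2⟩ := hS'
        exact (hmono _ _ (hm.le_iff.2 h1)).trans h2
      · rintro _ ⟨s, hs, rfl⟩
        exact hmono _ _ (hm.le_iff.1 (fun _ => le_rfl) s hs)

end Topological

/-! ### The quantale `[0, ∞]`. -/

section Approach

/-- The order is reversed, so `xi` is the supremum of the infima of the members of `𝔵` in the usual
order, a limit inferior; for a convergent ultrafilter this is the limit. -/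
theorem LawvereQuantale.xi_eq_of_le_nhds {𝔵 : Ultrafilter ENNReal} {x : ENNReal}
    (h : (𝔵 : Filter ENNReal) ≤ 𝓝 x) : xi (V := LawvereQuantale) 𝔵 = x := by
  have h1 : liminf id (𝔵 : Filter ENNReal) = x := Filter.Tendsto.liminf_eq h
  rw [liminf_eq_iSup_iInf] at h1
  simp only [id, ← sInf_eq_iInf] at h1
  exact h1

theorem isUltrafilterTheory_lawvereQuantale : IsUltrafilterTheory LawvereQuantale where
  one_eq_top := rfl
  xi_map_mul (𝔴 : Ultrafilter (ENNReal × ENNReal)) := by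
    -- Both projections converge because `[0, ∞]` is compact, and continuity of addition identifies
    -- the limit of the sums.
    have h1 := Ultrafilter.le_nhds_lim (X := ENNReal) (𝔴.map Prod.fst)
    have h2 := Ultrafilter.le_nhds_lim (X := ENNReal) (𝔴.map Prod.snd)
    have h3 : Tendsto (fun p : ENNReal × ENNReal => p.1 + p.2) (𝔴 : Filter _) _ := Tendsto.add h1 h2
    exact (LawvereQuantale.xi_eq_of_le_nhds
        (𝔵 := 𝔴.map fun p : ENNReal × ENNReal => p.1 + p.2) h3).trans
      (congrArg₂ (fun x y : LawvereQuantale => x * y) (LawvereQuantale.xi_eq_of_le_nhds h1)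
        (LawvereQuantale.xi_eq_of_le_nhds h2)).symm

end Approach
end UTheory
open UTheory

theorem mainTheorem3 :
    -- the general equivalence
    (∀ (V : Type v) [CommMonoid V] [CompletelyDistribLattice V] [IsQuantale V],
      IsUltrafilterTheory V →
      (1 : V) = ⊤ →
      DirectedOn (· ≤ ·) {r : V | TotallyBelow r 1} →
      (∀ r s : V, 1 ≤ r ⊔ s → 1 ≤ r ∨ 1 ≤ s) →
      ∀ (X : Type u) (a : UCat V X) (Φ : Omega a → V),
        IsVFunctor (Omega.vcat a) (homV V) Φ →
        PreservesInfima (Omega.vcat a) (homV V) Φ →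
        PreservesTensors (Omega.vcat a) (homV V) Φ →
        PreservesCotensors (Omega.vcat a) (homV V) Φ →
        UCompatible.{u, v, w} a Φ ∧
          (PreservesUSuprema.{u, v, w} a Φ ↔
            PreservesFiniteSuprema (Omega.vcat a) (homV V) Φ)) ∧
    -- the topological case
    (IsUltrafilterTheory Bool ∧
      ∀ (X : Type u) [TopologicalSpace X],
        Function.Bijective (ofClosed : Closeds X → Omega (ofTop X)) ∧
        (∀ C D : Closeds X,
          (Omega.vcat (ofTop X)).hom (ofClosed C) (ofClosed D) = true ↔ C ≤ D) ∧
        ∀ Φ : Omega (ofTop X) → Bool,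
          IsUFrameHom.{u, 0, w} (ofTop X) Φ ↔
            (∀ S : Set (Closeds X), Φ (ofClosed (sInf S)) = sInf ((fun C => Φ (ofClosed C)) '' S)) ∧
            Φ (ofClosed ⊥) = ⊥ ∧
            ∀ C D : Closeds X, Φ (ofClosed (C ⊔ D)) = Φ (ofClosed C) ⊔ Φ (ofClosed D)) ∧
    -- the approach case
    (IsUltrafilterTheory LawvereQuantale ∧
      ∀ (X : Type u) (a : UCat LawvereQuantale X) (Φ : Omega a → LawvereQuantale),
        IsUFrameHom.{u, 0, w} a Φ ↔
          (IsLimitTensorFunctor a Φ ∧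
            PreservesFiniteSuprema (Omega.vcat a) (homV LawvereQuantale) Φ)) := by
  refine ⟨fun V _ _ _ hV _ _ _ X a Φ hfun hinf _ _ =>
      ⟨uCompatible_of_preservesInfima hfun hinf, preservesUSuprema_iff hV hfun hinf⟩,
    ⟨isUltrafilterTheory_bool, fun X _ =>
      ⟨ofClosed_bijective, fun _ _ => ofClosed_hom_eq_true_iff, fun _ => isUFrameHom_ofTop_iff⟩⟩,
    ⟨isUltrafilterTheory_lawvereQuantale, fun X a Φ =>
      isUFrameHom_iff isUltrafilterTheory_lawvereQuantale⟩⟩
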